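/- Let $\mathbb K$ be $\mathbb R$ or $\mathbb C$, and let $r,d,n\ge 1$ be integers. Let $\mathcal O_r(\mathbb K^d)$ be the set of ordered $r$-tuples $\mathcal A=(A_1,\dots,A_r)$ of $d\times d$ matrices over $\mathbb K$, with the metric $\max_{1\le i\le r}|||A_i-B_i|||$, where $|||\cdot|||$ is the Euclidean operator norm. Let $\mathcal I_r(\mathbb K^d)\subset\mathcal O_r(\mathbb K^d)$ be the subspace of irreducible tuples, that is, those for which no linear subspace of $\mathbb K^d$ other than $\{0\}$ and $\mathbb K^d$ is preserved by every $A_i$. Let $$\varrho(\mathcal A)=\lim_{m\to\infty}\max_{1\le i_1,\dots,i_m\le r}|||A_{i_m}\cdots A_{i_1}|||^{1/m}$$ be the joint spectral radius. A Barabanov norm for $\mathcal A$ is a norm $\|\cdot\|$ on $\mathbb K^d$ such that $\varrho(\mathcal A)\|v\|=\max_{1\le i\le r}\|A_iv\|$ for every $v\in\mathbb K^d$; the same symbol denotes the induced operator norm on matrices. Let $\Omega_r^n=\{1,\dots,r\}^n$ be the set of words of length $n$, and write $z\sim\omega$ for $z,\omega\in\Omega_r^n$ if $z$ is a cyclic rotation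 of $\omega$. The tuple $\mathcal A\in\mathcal I_r(\mathbb K^d)$ satisfies the strong finiteness hypothesis with characteristic word $\omega\in\Omega_r^n$ if for every Barabanov norm $\|\cdot\|_B$ for $\mathcal A$ and every $z\in\Omega_r^n$ with $z\nsim\omega$ one has $\|A_{z_n}\cdots A_{z_1}\|_B<\varrho(\mathcal A)^n$. Theorem. For every $\omega\in\Omega_r^n$, the set of all $\mathcal A\in\mathcal I_r(\mathbb K^d)$ that satisfy the strong finiteness hypothesis with characteristic word $\omega$ is an open subset of $\mathcal I_r(\mathbb K^d)$. -/

import Mathlib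

open Filter Topology
open scoped Matrix Matrix.Norms.L2Operator

namespace JSR

/-- Ordered `r`-tuples of `d × d` matrices over `𝕜`. With the Euclidean operator norm on matrices
in force (scope `Matrix.Norms.L2Operator`), the instance metric on this product is
`max_i |||A_i - B_i|||`. -/
abbrev Tuple (𝕜 : Type*) (r d : ℕ) : Type _ := Fin r → Matrix (Fin d) (Fin d) 𝕜

/-- Words of length `n` over an alphabet of `r` letters. -/
abbrev Word (r n : ℕ) : Type := Fin n → Fin r

/-- The product `A_{w_n} ⋯ A_{w_1}` along the word `w = (w_1, …, w_n)`. -/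
def wordProd {𝕜 : Type*} [RCLike 𝕜] {r d n : ℕ} (A : Tuple 𝕜 r d) (w : Word r n) :
    Matrix (Fin d) (Fin d) 𝕜 :=
  (List.ofFn fun k => A (w k)).reverse.prod

/-- Two words of equal length are rotation equivalent if one is a cyclic rotation of the other. -/
def RotEquiv {r n : ℕ} (z w : Word r n) : Prop :=
  (List.ofFn w).IsRotated (List.ofFn z)

/-- `sup { ‖A_{w_n} ⋯ A_{w_1}‖^{1/n} }` over all words of length `n`, with the Euclidean
operator norm. -/
noncomputable def growth {𝕜 : Type*} [RCLike 𝕜] {r d : ℕ} (A : Tuple 𝕜 r d) (n : ℕ) : ℝ :=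
  ⨆ w : Word r n, ‖wordProd A w‖ ^ ((1 : ℝ) / n)

/-- The joint spectral radius. The limit always exists: see `tendsto_growth_jsr`. -/
noncomputable def jsr {𝕜 : Type*} [RCLike 𝕜] {r d : ℕ} (A : Tuple 𝕜 r d) : ℝ :=
  limUnder atTop (growth A)

/-- A tuple is irreducible if the only subspaces preserved by all its matrices are
`{0}` and the whole space. -/
def IsIrreducible {𝕜 : Type*} [RCLike 𝕜] {r d : ℕ} (A : Tuple 𝕜 r d) : Prop :=
  ∀ V : Submodule 𝕜 (Fin d → 𝕜), (∀ i, ∀ v ∈ V, A i *ᵥ v ∈ V) → V = ⊥ ∨ V = ⊤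

/-- The space of irreducible tuples, a subspace of the space of all tuples. -/
abbrev IrrTuple (𝕜 : Type*) [RCLike 𝕜] (r d : ℕ) : Type _ :=
  {A : Tuple 𝕜 r d // IsIrreducible A}

/-- A seminorm on `𝕜^d` is a norm if it vanishes only at zero. -/
def IsNorm {𝕜 : Type*} [RCLike 𝕜] {d : ℕ} (N : Seminorm 𝕜 (Fin d → 𝕜)) : Prop :=
  ∀ v, N v = 0 → v = 0

/-- The operator norm of a matrix induced by `N`. -/
noncomputable def opNorm {𝕜 : Type*} [RCLike 𝕜] {d : ℕ} (N : Seminorm 𝕜 (Fin d → 𝕜))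
    (M : Matrix (Fin d) (Fin d) 𝕜) : ℝ :=
  sInf {c : ℝ | 0 ≤ c ∧ ∀ v, N (M *ᵥ v) ≤ c * N v}

/-- Barabanov norms: norms `N` on `𝕜^d` with `ϱ(A) N(v) = max_i N(A_i v)` for all `v`. -/
def IsBarabanovNorm {𝕜 : Type*} [RCLike 𝕜] {r d : ℕ} (A : Tuple 𝕜 r d)
    (N : Seminorm 𝕜 (Fin d → 𝕜)) : Prop :=
  IsNorm N ∧ ∀ v, IsGreatest (Set.range fun i => N (A i *ᵥ v)) (jsr A * N v)

/-- The irreducible tuple `A` satisfies the strong finiteness hypothesis with characteristic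
word `w`. -/
def StrongFinitenessWith {𝕜 : Type*} [RCLike 𝕜] {r d n : ℕ} (A : IrrTuple 𝕜 r d)
    (w : Word r n) : Prop :=
  ∀ N : Seminorm 𝕜 (Fin d → 𝕜), IsBarabanovNorm A.1 N →
    ∀ z : Word r n, ¬ RotEquiv z w → opNorm N (wordProd A.1 z) < jsr A.1 ^ n

theorem norm_wordProd_le_iSup {𝕜 : Type*} [RCLike 𝕜] {r d n : ℕ} (A : Tuple 𝕜 r d)
    (w : Word r n) : ‖wordProd A w‖ ≤ ⨆ z : Word r n, ‖wordProd A z‖ :=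
  le_ciSup (Set.finite_range fun z : Word r n => ‖wordProd A z‖).bddAbove w

theorem iSup_norm_wordProd_nonneg {𝕜 : Type*} [RCLike 𝕜] {r d : ℕ} (A : Tuple 𝕜 r d) (n : ℕ) :
    0 ≤ ⨆ z : Word r n, ‖wordProd A z‖ :=
  Real.iSup_nonneg fun _ => norm_nonneg _

theorem iSup_norm_wordProd_add {𝕜 : Type*} [RCLike 𝕜] {r d : ℕ} (A : Tuple 𝕜 r d) (m n : ℕ) :
    (⨆ z : Word r (m + n), ‖wordProd A z‖) ≤
      (⨆ z : Word r m, ‖wordProd A z‖) * ⨆ z : Word r n, ‖wordProd A z‖ := by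
  have h0 := iSup_norm_wordProd_nonneg A
  refine Real.iSup_le (fun w => ?_) (mul_nonneg (h0 m) (h0 n))
  have hw : wordProd A w = wordProd A (fun k : Fin n => w (Fin.natAdd m k)) *
      wordProd A (fun k : Fin m => w (Fin.castAdd n k)) := by
    simp only [wordProd, List.ofFn_add, List.reverse_append, List.prod_append]
    rfl
  rw [hw, mul_comm (⨆ z : Word r m, ‖wordProd A z‖)]
  exact (norm_mul_le _ _).trans (mul_le_mul (norm_wordProd_le_iSup A _)
    (norm_wordProd_le_iSup A _) (norm_nonneg _) (h0 n))

theorem growth_eq {𝕜 : Type*} [RCLike 𝕜] {r d : ℕ} (A : Tuple 𝕜 r d) {n : ℕ} (hn : n ≠ 0) :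
    growth A n = (⨆ z : Word r n, ‖wordProd A z‖) ^ ((1 : ℝ) / n) := by
  have h0 := iSup_norm_wordProd_nonneg A n
  have hp : (0 : ℝ) < (1 : ℝ) / n := by positivity
  apply le_antisymm
  · exact Real.iSup_le (fun w => Real.rpow_le_rpow (norm_nonneg _)
      (norm_wordProd_le_iSup A w) hp.le) (Real.rpow_nonneg h0 _)
  · rcases isEmpty_or_nonempty (Word r n) with h | h
    · simp [growth, Real.iSup_of_isEmpty, Real.zero_rpow, hn]
    · obtain ⟨w, hw⟩ := exists_eq_ciSup_of_finite (f := fun z : Word r n => ‖wordProd A z‖)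
      rw [← hw]
      exact le_ciSup (f := fun z : Word r n => ‖wordProd A z‖ ^ ((1 : ℝ) / n))
        (Set.finite_range _).bddAbove w

/-- The limit in the definition of the joint spectral radius exists. -/
theorem tendsto_growth_jsr {𝕜 : Type*} [RCLike 𝕜] {r d : ℕ} (A : Tuple 𝕜 r d) :
    Tendsto (growth A) atTop (𝓝 (jsr A)) := by
  apply tendsto_nhds_limUnder
  set c : ℕ → ℝ := fun n => ⨆ z : Word r n, ‖wordProd A z‖ with hc
  have h0 : ∀ n, 0 ≤ c n := iSup_norm_wordProd_nonneg A
  have hadd : ∀ m n, c (m + n) ≤ c m * c n := iSup_norm_wordProd_add A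
  by_cases hz : ∃ N, c N = 0
  · obtain ⟨N, hN⟩ := hz
    refine ⟨0, tendsto_const_nhds.congr' ?_⟩
    filter_upwards [eventually_ge_atTop (N + 1)] with n hn
    obtain ⟨k, rfl⟩ := Nat.exists_eq_add_of_le (by omega : N ≤ n)
    have hk : c (N + k) = 0 := le_antisymm ((hadd N k).trans (by simp [hN])) (h0 _)
    have hne : N + k ≠ 0 := by omega
    have hne' : (1 : ℝ) / ((N + k : ℕ) : ℝ) ≠ 0 := by positivity
    rw [growth_eq A hne]
    exact (by rw [show (⨆ z : Word r (N + k), ‖wordProd A z‖) = 0 from hk,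
      Real.zero_rpow hne'])
  · push Not at hz
    have hpos : ∀ n, 0 < c n := fun n => lt_of_le_of_ne (h0 n) (Ne.symm (hz n))
    have hsub : Subadditive fun n => Real.log (c n) := by
      intro m n
      rw [← Real.log_mul (hz m) (hz n)]
      exact Real.log_le_log (hpos _) (hadd m n)
    have hg : ∀ᶠ n in atTop, Real.exp (Real.log (c n) / n) = growth A n := by
      filter_upwards [eventually_ne_atTop 0] with n hn
      rw [growth_eq A hn, Real.rpow_def_of_pos (hpos n)]
      congr 1
      ring
    by_cases hb : BddBelow (Set.range fun n => Real.log (c n) / n)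
    · exact ⟨_, ((Real.continuous_exp.tendsto _).comp (hsub.tendsto_lim hb)).congr' hg⟩
    · refine ⟨0, (Real.tendsto_exp_atBot.comp (tendsto_atBot.2 fun L => ?_)).congr' hg⟩
      rw [not_bddBelow_iff] at hb
      obtain ⟨_, ⟨n, rfl⟩, hn⟩ := hb (min L 0)
      have hn0 : n ≠ 0 := by
        rintro rfl
        simp at hn
      filter_upwards [hsub.eventually_div_lt_of_div_lt hn0
        (lt_of_lt_of_le hn (min_le_left _ _))] with p hp using hp.le

end JSR

/-!
The complement is closed, by compactness of the set of suitably normalised seminorms.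

Suppose irreducible tuples `B` violating the hypothesis accumulate at the irreducible tuple `A`, and
let `U` be an ultrafilter of such tuples converging to `A`. Each `B` comes with a Barabanov norm
`N_B`, which can be scaled to have maximum `1` on the unit sphere of the supremum norm, and with a
word `z_B` not rotation equivalent to `ω` and a unit vector `v_B` with
`jsr B ^ n * N_B v_B ≤ N_B (B_{z_B} v_B)`, the operator norm being attained
(`exists_violation`). The norms are `1`-Lipschitz and the numbers `jsr B` bounded, so everything
converges along `U` (`Ultrafilter.exists_seminorm_tendsto`), and the limit `N` is a seminorm,
equal to `1` at some unit vector, with `ρ * N v = max_i N (A_i v)` for `ρ = lim jsr B`. This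
identity makes the kernel of `N` invariant under all `A_i`, so irreducibility of `A` forces `N` to
be a norm (`isNorm_of_isGreatest`). A norm can satisfy the identity only with `ρ = jsr A`
(`jsr_eq_of_isGreatest`); hence `N` is a Barabanov norm for `A`, and the limits of `z_B` and `v_B`
show that `A` violates the hypothesis as well. The limit step is
`exists_isBarabanovNorm_tendsto`; continuity of the joint spectral radius need not be
known beforehand, it comes out of the same argument.
-/

namespace JSR

variable {𝕜 : Type*} [RCLike 𝕜] {r d n : ℕ}

/-! ### Seminorms in finite dimension -/

theorem continuous_seminorm (p : Seminorm 𝕜 (Fin d → 𝕜)) : Continuous p := by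
  set C : ℝ := ∑ i, p (Pi.single i 1)
  have hC : 0 ≤ C := Finset.sum_nonneg fun i _ => apply_nonneg p _
  have hle : ∀ v, p v ≤ C * ‖v‖ := fun v => by
    have hv : v = ∑ i, v i • (Pi.single i 1 : Fin d → 𝕜) := by
      ext j
      simp [Finset.sum_apply, Pi.single_apply]
    calc p v = p (∑ i, v i • (Pi.single i 1 : Fin d → 𝕜)) := by rw [← hv]
      _ ≤ ∑ i, p (v i • (Pi.single i 1 : Fin d → 𝕜)) := by
        exact Finset.le_sum_of_subadditive p (map_zero p).le (map_add_le_add p) _ _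
      _ ≤ ∑ i, ‖v‖ * p (Pi.single i 1) := by
        refine Finset.sum_le_sum fun i _ => ?_
        rw [map_smul_eq_mul]
        exact mul_le_mul_of_nonneg_right (norm_le_pi_norm v i) (apply_nonneg p _)
      _ = C * ‖v‖ := by rw [← Finset.mul_sum, mul_comm]
  refine (LipschitzWith.of_dist_le_mul (K := ⟨C, hC⟩) fun x y => ?_).continuous
  rw [Real.dist_eq, dist_eq_norm]
  exact (abs_sub_map_le_sub p x y).trans (hle _)

theorem IsNorm.pos {p : Seminorm 𝕜 (Fin d → 𝕜)} (hp : IsNorm p) {v : Fin d → 𝕜} (hv : v ≠ 0) :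
    0 < p v :=
  lt_of_le_of_ne (apply_nonneg p v) fun h => hv (hp v h.symm)

/-- The ratio of a seminorm to a norm attains its maximum, at a vector of the unit sphere. -/
theorem IsNorm.exists_isMaxOn_ratio (hd : 0 < d) {p : Seminorm 𝕜 (Fin d → 𝕜)} (hp : IsNorm p)
    (q : Seminorm 𝕜 (Fin d → 𝕜)) :
    ∃ u : Fin d → 𝕜, ‖u‖ = 1 ∧ ∀ v, q v ≤ q u / p u * p v := by
  have : Nonempty (Fin d) := ⟨⟨0, hd⟩⟩
  have hne : ∀ v ∈ Metric.sphere (0 : Fin d → 𝕜) 1, v ≠ 0 := fun v hv =>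
    ne_zero_of_mem_unit_sphere ⟨v, hv⟩
  obtain ⟨u, hu, hmax⟩ := (isCompact_sphere (0 : Fin d → 𝕜) 1).exists_isMaxOn
    ⟨fun _ => 1, by simp⟩
    ((continuous_seminorm q).continuousOn.div (continuous_seminorm p).continuousOn
      fun v hv => (hp.pos (hne v hv)).ne')
  refine ⟨u, by simpa using hu, fun v => ?_⟩
  rcases eq_or_ne v 0 with rfl | hv
  · simp
  have hv' : ‖v‖ ≠ 0 := norm_ne_zero_iff.2 hv
  have hmem : ((‖v‖⁻¹ : ℝ) : 𝕜) • v ∈ Metric.sphere (0 : Fin d → 𝕜) 1 := by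
    simp [norm_smul, hv']
  have h := hmax hmem
  simp only [Set.mem_ofPred_eq, Pi.div_apply, map_smul_eq_mul] at h
  rwa [mul_div_mul_left _ _ (norm_ne_zero_iff.2 (by simpa using hv)), div_le_iff₀ (hp.pos hv)] at h

/-- The seminorm `v ↦ N (M v)`. -/
noncomputable def mulVecSeminorm (N : Seminorm 𝕜 (Fin d → 𝕜)) (M : Matrix (Fin d) (Fin d) 𝕜) :
    Seminorm 𝕜 (Fin d → 𝕜) :=
  N.comp M.mulVecLin

@[simp]
theorem mulVecSeminorm_apply (N : Seminorm 𝕜 (Fin d → 𝕜)) (M : Matrix (Fin d) (Fin d) 𝕜)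
    (v : Fin d → 𝕜) : mulVecSeminorm N M v = N (M *ᵥ v) :=
  rfl

/-- If `N` is a norm, then `opNorm N M` is at least `c` exactly if this is witnessed by a single
unit vector. -/
theorem IsNorm.le_opNorm_iff (hd : 0 < d) {N : Seminorm 𝕜 (Fin d → 𝕜)} (hN : IsNorm N)
    (M : Matrix (Fin d) (Fin d) 𝕜) (c : ℝ) :
    c ≤ opNorm N M ↔ ∃ v : Fin d → 𝕜, ‖v‖ = 1 ∧ c * N v ≤ N (M *ᵥ v) := by
  obtain ⟨u, hu, hmax⟩ := hN.exists_isMaxOn_ratio hd (mulVecSeminorm N M)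
  simp only [mulVecSeminorm_apply] at hmax
  have hpos : ∀ v : Fin d → 𝕜, ‖v‖ = 1 → 0 < N v := fun v hv =>
    hN.pos (norm_ne_zero_iff.1 (by simp [hv]))
  have hmem : N (M *ᵥ u) / N u ∈ {c : ℝ | 0 ≤ c ∧ ∀ v, N (M *ᵥ v) ≤ c * N v} :=
    ⟨div_nonneg (apply_nonneg N _) (apply_nonneg N _), hmax⟩
  refine ⟨fun h => ⟨u, hu, ?_⟩, fun ⟨v, hv, h⟩ => ?_⟩
  · rw [← le_div_iff₀ (hpos u hu)]
    exact h.trans (csInf_le ⟨0, fun _ hc => hc.1⟩ hmem)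
  · exact le_csInf ⟨_, hmem⟩ fun b hb => le_of_mul_le_mul_right (h.trans (hb.2 v)) (hpos v hv)

/-- The operator norm induced by a norm is equivalent to the Euclidean operator norm. -/
theorem IsNorm.exists_norm_equiv (hd : 0 < d) {N : Seminorm 𝕜 (Fin d → 𝕜)} (hN : IsNorm N) :
    ∃ C : ℝ, 0 < C ∧ (∀ (M : Matrix (Fin d) (Fin d) 𝕜) (c : ℝ), 0 ≤ c →
        (∀ v, N (M *ᵥ v) ≤ c * N v) → ‖M‖ ≤ C * c) ∧
      ∀ (M : Matrix (Fin d) (Fin d) 𝕜) v, N (M *ᵥ v) ≤ C * ‖M‖ * N v := by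
  set e : Seminorm 𝕜 (Fin d → 𝕜) := (normSeminorm 𝕜 (EuclideanSpace 𝕜 (Fin d))).comp
    (WithLp.linearEquiv 2 𝕜 (Fin d → 𝕜)).symm.toLinearMap
  have he : IsNorm e := fun v hv => by
    have h : WithLp.toLp 2 v = 0 := norm_eq_zero.1 hv
    simpa using h
  have heM : ∀ (M : Matrix (Fin d) (Fin d) 𝕜) v, e (M *ᵥ v) ≤ ‖M‖ * e v := fun M v =>
    Matrix.l2_opNorm_mulVec M (WithLp.toLp 2 v)
  obtain ⟨u, -, hu⟩ := hN.exists_isMaxOn_ratio hd e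
  obtain ⟨w, -, hw⟩ := he.exists_isMaxOn_ratio hd N
  set a := e u / N u
  set b := N w / e w
  have ha : 0 ≤ a := div_nonneg (apply_nonneg e _) (apply_nonneg N _)
  have hb : 0 ≤ b := div_nonneg (apply_nonneg N _) (apply_nonneg e _)
  refine ⟨a * b + 1, by positivity, fun M c hc hM => ?_, fun M v => ?_⟩
  · refine le_trans (b := a * b * c) ?_ (by nlinarith)
    rw [← Matrix.l2_opNorm_toEuclideanCLM]
    refine ContinuousLinearMap.opNorm_le_bound _ (by positivity) fun x => ?_
    calc e (M *ᵥ x.ofLp) ≤ a * N (M *ᵥ x.ofLp) := hu _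
      _ ≤ a * (c * (b * e x.ofLp)) := by
        gcongr
        exact (hM _).trans (mul_le_mul_of_nonneg_left (hw _) hc)
      _ = a * b * c * e x.ofLp := by ring
  · calc N (M *ᵥ v) ≤ b * e (M *ᵥ v) := hw _
      _ ≤ b * (‖M‖ * (a * N v)) := by
        gcongr
        exact (heM M v).trans (mul_le_mul_of_nonneg_left (hu _) (norm_nonneg _))
      _ = a * b * ‖M‖ * N v := by ring
      _ ≤ (a * b + 1) * ‖M‖ * N v := by
        have := apply_nonneg N v
        gcongr
        linarith

/-! ### The joint spectral radius from a Barabanov identity -/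

theorem wordProd_cons (A : Tuple 𝕜 r d) (i : Fin r) (w : Word r n) :
    wordProd A (Fin.cons i w : Word r (n + 1)) = wordProd A w * A i := by
  simp [wordProd, List.ofFn_succ]

theorem wordProd_zero (A : Tuple 𝕜 r d) (w : Word r 0) : wordProd A w = 1 := by
  simp [wordProd]

section Barabanov

variable {A : Tuple 𝕜 r d} {N : Seminorm 𝕜 (Fin d → 𝕜)} {ρ : ℝ}

theorem nonneg_of_isGreatest {u : Fin d → 𝕜} (hu : 0 < N u)
    (h : ∀ v, IsGreatest (Set.range fun i => N (A i *ᵥ v)) (ρ * N v)) : 0 ≤ ρ := by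
  obtain ⟨i, hi⟩ := (h u).1
  exact nonneg_of_mul_nonneg_left (hi ▸ apply_nonneg N _) hu

theorem apply_wordProd_le (hρ : 0 ≤ ρ)
    (h : ∀ v, IsGreatest (Set.range fun i => N (A i *ᵥ v)) (ρ * N v)) (m : ℕ) :
    ∀ (w : Word r m) (v : Fin d → 𝕜), N (wordProd A w *ᵥ v) ≤ ρ ^ m * N v := by
  induction m with
  | zero => intro w v; simp [wordProd_zero]
  | succ m ih =>
    intro w v
    rw [← Fin.cons_self_tail w, wordProd_cons, ← Matrix.mulVec_mulVec]
    calc _ ≤ ρ ^ m * N (A (w 0) *ᵥ v) := ih _ _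
      _ ≤ ρ ^ m * (ρ * N v) :=
        mul_le_mul_of_nonneg_left ((h v).2 ⟨w 0, rfl⟩) (pow_nonneg hρ m)
      _ = ρ ^ (m + 1) * N v := by ring

theorem exists_apply_wordProd_eq
    (h : ∀ v, IsGreatest (Set.range fun i => N (A i *ᵥ v)) (ρ * N v)) (m : ℕ) :
    ∀ v : Fin d → 𝕜, ∃ w : Word r m, N (wordProd A w *ᵥ v) = ρ ^ m * N v := by
  induction m with
  | zero => intro v; exact ⟨Fin.elim0, by simp [wordProd_zero]⟩
  | succ m ih =>
    intro v
    obtain ⟨i, hi⟩ := (h v).1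
    obtain ⟨w, hw⟩ := ih (A i *ᵥ v)
    refine ⟨Fin.cons i w, ?_⟩
    rw [wordProd_cons, ← Matrix.mulVec_mulVec, hw, show N (A i *ᵥ v) = ρ * N v from hi]
    ring

theorem tendsto_const_rpow_one_div {C : ℝ} (hC : 0 < C) :
    Tendsto (fun m : ℕ => C ^ ((1 : ℝ) / m)) atTop (𝓝 1) := by
  simpa [Function.comp_def] using (Real.continuousAt_const_rpow hC.ne' (b := 0)).tendsto.comp
    (tendsto_one_div_atTop_nhds_zero_nat (𝕜 := ℝ))

/-- A norm with `ρ * N v = max_i N (A_i v)` pins down the joint spectral radius: iterating the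
identity, the products of length `m` have maximal norm `ρ ^ m` in the operator norm of `N`, which
differs from the Euclidean one by a bounded factor only. -/
theorem jsr_eq_of_isGreatest (hd : 0 < d) (hN : IsNorm N)
    (h : ∀ v, IsGreatest (Set.range fun i => N (A i *ᵥ v)) (ρ * N v)) : jsr A = ρ := by
  obtain ⟨C, hC, hle, hge⟩ := hN.exists_norm_equiv hd
  have hu : 0 < N (fun _ => 1) := hN.pos fun h0 => one_ne_zero (congrFun h0 ⟨0, hd⟩)
  have hρ := nonneg_of_isGreatest hu h
  have hroot : ∀ m : ℕ, m ≠ 0 → (ρ ^ m) ^ ((1 : ℝ) / m) = ρ := fun m hm => by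
    rw [one_div, Real.pow_rpow_inv_natCast hρ hm]
  refine tendsto_nhds_unique (tendsto_growth_jsr A) ?_
  refine tendsto_of_tendsto_of_tendsto_of_le_of_le' (g := fun m : ℕ => C⁻¹ ^ ((1 : ℝ) / m) * ρ)
    (h := fun m : ℕ => C ^ ((1 : ℝ) / m) * ρ) ?_ ?_ ?_ ?_
  · simpa using (tendsto_const_rpow_one_div (inv_pos.2 hC)).mul_const ρ
  · simpa using (tendsto_const_rpow_one_div hC).mul_const ρ
  · filter_upwards [eventually_ne_atTop 0] with m hm
    rw [growth_eq A hm]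
    nth_rw 1 [← hroot m hm]
    rw [← Real.mul_rpow (inv_nonneg.2 hC.le) (pow_nonneg hρ m)]
    refine Real.rpow_le_rpow (by positivity) ?_ (by positivity)
    obtain ⟨w, hw⟩ := exists_apply_wordProd_eq h m (fun _ => 1)
    rw [inv_mul_le_iff₀ hC]
    calc ρ ^ m ≤ C * ‖wordProd A w‖ := le_of_mul_le_mul_right (hw ▸ hge _ _) hu
      _ ≤ _ := mul_le_mul_of_nonneg_left (norm_wordProd_le_iSup A w) hC.le
  · filter_upwards [eventually_ne_atTop 0] with m hm
    rw [growth_eq A hm]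
    nth_rw 1 [← hroot m hm]
    rw [← Real.mul_rpow hC.le (pow_nonneg hρ m)]
    refine Real.rpow_le_rpow (iSup_norm_wordProd_nonneg A m) ?_ (by positivity)
    exact Real.iSup_le (fun w => hle _ _ (pow_nonneg hρ m) (apply_wordProd_le hρ h m w))
      (by positivity)

/-- For an irreducible tuple, a nonzero seminorm satisfying the Barabanov identity is a norm: its
kernel is invariant. -/
theorem isNorm_of_isGreatest (hA : IsIrreducible A)
    (h : ∀ v, IsGreatest (Set.range fun i => N (A i *ᵥ v)) (ρ * N v)) {u : Fin d → 𝕜}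
    (hu : N u ≠ 0) : IsNorm N := by
  let V : Submodule 𝕜 (Fin d → 𝕜) :=
    { carrier := {v | N v = 0}
      zero_mem' := map_zero N
      add_mem' := fun {a b} (ha : N a = 0) (hb : N b = 0) =>
        le_antisymm ((map_add_le_add N a b).trans (by simp [ha, hb])) (apply_nonneg N _)
      smul_mem' := fun c v (hv : N v = 0) => by simp [map_smul_eq_mul, hv] }
  have hV : ∀ i, ∀ v ∈ V, A i *ᵥ v ∈ V := fun i v (hv : N v = 0) => by
    have := (h v).2 ⟨i, rfl⟩
    exact le_antisymm (by simpa [hv] using this) (apply_nonneg N _)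
  rcases hA V hV with hbot | htop
  · intro v hv
    have : v ∈ V := hv
    simpa [hbot] using this
  · have : u ∈ V := htop ▸ Submodule.mem_top
    exact absurd this hu

/-- A tuple violating the strong finiteness hypothesis does so through a Barabanov norm with
maximum `1` on the unit sphere, and through a unit vector at which that norm is expanded enough. -/
theorem exists_violation (hd : 0 < d) {ω : Word r n} {B : IrrTuple 𝕜 r d}
    (hB : ¬ StrongFinitenessWith B ω) :
    ∃ (N : Seminorm 𝕜 (Fin d → 𝕜)) (z : Word r n) (u v : Fin d → 𝕜),
      (∀ x, N x ≤ ‖x‖) ∧ ‖u‖ = 1 ∧ N u = 1 ∧ ‖v‖ = 1 ∧ ¬ RotEquiv z ω ∧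
      (∀ x, IsGreatest (Set.range fun i => N (B.1 i *ᵥ x)) (jsr B.1 * N x)) ∧
      jsr B.1 ^ n * N v ≤ N (wordProd B.1 z *ᵥ v) := by
  simp only [StrongFinitenessWith, not_forall, not_lt] at hB
  obtain ⟨N, ⟨hN, hgr⟩, z, hz, hop⟩ := hB
  obtain ⟨v, hv, hv'⟩ := (hN.le_opNorm_iff hd _ _).1 hop
  obtain ⟨u, hu, hmax⟩ := IsNorm.exists_isMaxOn_ratio hd
    (p := normSeminorm 𝕜 (Fin d → 𝕜)) (fun v hv => norm_eq_zero.1 hv) N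
  simp only [coe_normSeminorm, hu, div_one] at hmax
  have hpos : 0 < N u := hN.pos (norm_ne_zero_iff.1 (by simp [hu]))
  have hN' : ∀ x, ((N u)⁻¹.toNNReal • N) x = (N u)⁻¹ * N x := fun x => by
    rw [smul_apply, NNReal.smul_def, Real.coe_toNNReal _ (inv_nonneg.2 hpos.le),
      smul_eq_mul]
  refine ⟨(N u)⁻¹.toNNReal • N, z, u, v, fun x => ?_, hu, ?_, hv, hz, fun x => ⟨?_, ?_⟩, ?_⟩
  · rw [hN', inv_mul_le_iff₀ hpos]
    exact hmax x
  · rw [hN', inv_mul_cancel₀ hpos.ne']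
  · obtain ⟨i, hi⟩ := (hgr x).1
    refine ⟨i, ?_⟩
    simp only [hN']
    rw [show N (B.1 i *ᵥ x) = _ from hi]
    ring
  · rintro _ ⟨i, rfl⟩
    simp only [hN']
    rw [mul_left_comm]
    exact mul_le_mul_of_nonneg_left ((hgr x).2 ⟨i, rfl⟩) (inv_nonneg.2 hpos.le)
  · rw [hN', hN', mul_left_comm]
    exact mul_le_mul_of_nonneg_left hv' (inv_nonneg.2 hpos.le)

end Barabanov

/-! ### Limits along ultrafilters -/

theorem _root_.Ultrafilter.exists_tendsto_of_mem_compact {ι X : Type*} [TopologicalSpace X]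
    (U : Ultrafilter ι) {K : Set X} (hK : IsCompact K) {f : ι → X} (hf : ∀ᶠ b in U, f b ∈ K) :
    ∃ x ∈ K, Tendsto f U (𝓝 x) :=
  hK.ultrafilter_le_nhds (U.map f) (le_principal_iff.2 hf)

/-- Seminorms bounded by the norm converge pointwise along every ultrafilter. Being uniformly
Lipschitz, they then converge along convergent arguments too. -/
theorem _root_.Ultrafilter.exists_seminorm_tendsto {ι E : Type*} [NormedAddCommGroup E]
    [NormedSpace 𝕜 E] (U : Ultrafilter ι) {N : ι → Seminorm 𝕜 E}
    (hN : ∀ᶠ b in U, ∀ x, N b x ≤ ‖x‖) :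
    ∃ L : Seminorm 𝕜 E, ∀ (f : ι → E) (x : E), Tendsto f U (𝓝 x) →
      Tendsto (fun b => N b (f b)) U (𝓝 (L x)) := by
  have hlim : ∀ x, ∃ l : ℝ, Tendsto (fun b => N b x) U (𝓝 l) := fun x => by
    obtain ⟨l, -, hl⟩ := U.exists_tendsto_of_mem_compact (isCompact_Icc (a := 0) (b := ‖x‖))
      (f := fun b => N b x) (hN.mono fun b hb => ⟨apply_nonneg _ _, hb x⟩)
    exact ⟨l, hl⟩
  choose L hL using hlim
  refine ⟨Seminorm.of L (fun x y => le_of_tendsto_of_tendsto (hL _) ((hL x).add (hL y))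
    (Eventually.of_forall fun b => map_add_le_add (N b) x y)) fun a x =>
    tendsto_nhds_unique (hL _) (((hL x).const_mul ‖a‖).congr fun b =>
      (map_smul_eq_mul (N b) a x).symm), fun f x hf => ?_⟩
  have hdiff : Tendsto (fun b => N b (f b) - N b x) U (𝓝 0) := by
    refine squeeze_zero_norm' (a := fun b => ‖f b - x‖) (hN.mono fun b hb => ?_)
      (tendsto_iff_norm_sub_tendsto_zero.1 hf)
    exact (abs_sub_map_le_sub (N b) _ _).trans (hb _)
  have hsum := hdiff.add (hL x)
  simp only [sub_add_cancel, zero_add] at hsum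
  exact hsum

theorem continuous_wordProd (w : Word r n) :
    Continuous fun A : Tuple 𝕜 r d => wordProd A w := by
  induction n with
  | zero => simp only [wordProd_zero]; exact continuous_const
  | succ n ih =>
    rw [← Fin.cons_self_tail w]
    simp only [wordProd_cons]
    exact (ih _).mul (continuous_apply (w 0))

theorem tendsto_mulVec {ι : Type*} {l : Filter ι} {M : ι → Matrix (Fin d) (Fin d) 𝕜}
    {M₀ : Matrix (Fin d) (Fin d) 𝕜} {x : ι → Fin d → 𝕜} {x₀ : Fin d → 𝕜}
    (hM : Tendsto M l (𝓝 M₀)) (hx : Tendsto x l (𝓝 x₀)) :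
    Tendsto (fun b => M b *ᵥ x b) l (𝓝 (M₀ *ᵥ x₀)) := by
  have hc : Continuous fun p : Matrix (Fin d) (Fin d) 𝕜 × (Fin d → 𝕜) => p.1 *ᵥ p.2 :=
    Continuous.matrix_mulVec continuous_fst continuous_snd
  have h := (hc.tendsto (M₀, x₀)).comp (hM.prodMk_nhds hx)
  exact h

/-- Barabanov norms with maximum `1` on the unit sphere, for tuples converging to an irreducible
tuple, converge along every ultrafilter to a Barabanov norm of the limit, and the joint spectral
radii converge too. -/
theorem exists_isBarabanovNorm_tendsto (hd : 0 < d) {ι : Type*} (U : Ultrafilter ι)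
    {A : Tuple 𝕜 r d} (hA : IsIrreducible A) {B : ι → Tuple 𝕜 r d} (hBA : Tendsto B U (𝓝 A))
    {N : ι → Seminorm 𝕜 (Fin d → 𝕜)} {u : ι → Fin d → 𝕜}
    (hle : ∀ᶠ b in U, ∀ x, N b x ≤ ‖x‖) (hu : ∀ᶠ b in U, ‖u b‖ = 1)
    (hNu : ∀ᶠ b in U, N b (u b) = 1)
    (hgr : ∀ᶠ b in U, ∀ x,
      IsGreatest (Set.range fun i => N b (B b i *ᵥ x)) (jsr (B b) * N b x)) :
    ∃ L : Seminorm 𝕜 (Fin d → 𝕜), IsBarabanovNorm A L ∧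
      Tendsto (fun b => jsr (B b)) U (𝓝 (jsr A)) ∧
      ∀ (f : ι → Fin d → 𝕜) (x : Fin d → 𝕜), Tendsto f U (𝓝 x) →
        Tendsto (fun b => N b (f b)) U (𝓝 (L x)) := by
  obtain ⟨L, hL⟩ := U.exists_seminorm_tendsto hle
  obtain ⟨u₀, -, hu₀⟩ := U.exists_tendsto_of_mem_compact
    (isCompact_sphere (0 : Fin d → 𝕜) 1) (f := u) (by simpa using hu)
  have hLu : L u₀ = 1 :=
    tendsto_nhds_unique (hL u u₀ hu₀) (tendsto_const_nhds.congr' (hNu.mono fun b h => h.symm))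
  -- Evaluating the Barabanov identity at `u b` bounds `jsr (B b)` by the norms of the vectors
  -- `B b i *ᵥ u b`, which converge.
  obtain ⟨ρ, hρ⟩ : ∃ ρ : ℝ, Tendsto (fun b => jsr (B b)) U (𝓝 ρ) := by
    have hbd : ∀ᶠ b in U, jsr (B b) ∈ Set.Icc 0 (∑ i, (L (A i *ᵥ u₀) + 1)) := by
      have hi : ∀ᶠ b in U, ∀ i, N b (B b i *ᵥ u b) < L (A i *ᵥ u₀) + 1 :=
        eventually_all.2 fun i =>
          (hL _ _ (tendsto_mulVec (tendsto_pi_nhds.1 hBA i) hu₀)).eventually_lt_const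
            (lt_add_one _)
      filter_upwards [hi, hNu, hgr] with b hi hNu hgr
      refine ⟨nonneg_of_isGreatest (hNu ▸ one_pos) hgr, ?_⟩
      obtain ⟨j, hj⟩ := (hgr (u b)).1
      simp only [hNu, mul_one] at hj
      rw [← hj]
      exact (hi j).le.trans (Finset.single_le_sum (f := fun i => L (A i *ᵥ u₀) + 1)
        (fun i _ => add_nonneg (apply_nonneg L _) zero_le_one) (Finset.mem_univ j))
    obtain ⟨ρ, -, h⟩ := U.exists_tendsto_of_mem_compact isCompact_Icc hbd
    exact ⟨ρ, h⟩
  have hgrL : ∀ x, IsGreatest (Set.range fun i => L (A i *ᵥ x)) (ρ * L x) := fun x => by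
    have hx := hL (fun _ => x) x tendsto_const_nhds
    have hAx := fun i =>
      hL _ _ (tendsto_mulVec (tendsto_pi_nhds.1 hBA i) (tendsto_const_nhds (x := x)))
    refine ⟨?_, ?_⟩
    · -- The index attaining the maximum is constant along the ultrafilter.
      obtain ⟨i, hi⟩ : ∃ i, ∀ᶠ b in U, N b (B b i *ᵥ x) = jsr (B b) * N b x :=
        Ultrafilter.eventually_exists_iff.1 (hgr.mono fun b h => (h x).1)
      exact ⟨i, tendsto_nhds_unique (hAx i) ((hρ.mul hx).congr' (hi.mono fun b h => h.symm))⟩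
    · rintro _ ⟨i, rfl⟩
      exact le_of_tendsto_of_tendsto (hAx i) (hρ.mul hx) (hgr.mono fun b h => (h x).2 ⟨i, rfl⟩)
  have hLnorm : IsNorm L := isNorm_of_isGreatest hA hgrL (u := u₀) (by simp [hLu])
  obtain rfl : jsr A = ρ := jsr_eq_of_isGreatest hd hLnorm hgrL
  exact ⟨L, ⟨hLnorm, hgrL⟩, hρ, hL⟩

theorem isOpen_strongFinitenessWith (hd : 0 < d) (ω : Word r n) :
    IsOpen {A : IrrTuple 𝕜 r d | StrongFinitenessWith A ω} := by
  rw [← isClosed_compl_iff]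
  refine isClosed_of_closure_subset fun A hA => ?_
  obtain ⟨U, hU, hUA⟩ := mem_closure_iff_ultrafilter.1 hA
  have hbad : ∀ᶠ B : IrrTuple 𝕜 r d in U, ¬ StrongFinitenessWith B ω := hU
  have hviol := fun B : {B : IrrTuple 𝕜 r d // ¬ StrongFinitenessWith B ω} =>
    exists_violation hd B.2
  choose N z u v hle hu hNu hv hz hgr hexp using hviol
  -- Restrict the ultrafilter to the set of tuples violating the hypothesis.
  set W := U.comap Subtype.val_injective (m := Subtype.val (p := fun B : IrrTuple 𝕜 r d =>
    ¬ StrongFinitenessWith B ω)) (by rw [Subtype.range_coe_subtype]; exact hbad)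
  have hWA : Tendsto (fun B : {B : IrrTuple 𝕜 r d // ¬ StrongFinitenessWith B ω} => B.1.1) W
      (𝓝 A.1) := by
    refine ((continuous_subtype_val.tendsto A).mono_left hUA).comp ?_
    rw [Ultrafilter.coe_comap]
    exact tendsto_comap
  have all {p : {B : IrrTuple 𝕜 r d // ¬ StrongFinitenessWith B ω} → Prop} (h : ∀ b, p b) :
      ∀ᶠ b in W, p b := Eventually.of_forall h
  obtain ⟨L, hLA, hρ, hL⟩ := exists_isBarabanovNorm_tendsto hd W A.2 hWA (all hle) (all hu)
    (all hNu) (all hgr)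
  obtain ⟨v₀, hv₀, hvv⟩ := W.exists_tendsto_of_mem_compact (isCompact_sphere (0 : Fin d → 𝕜) 1)
    (f := v) (all fun B => by simpa using hv B)
  obtain ⟨z₀, hz₀⟩ : ∃ z₀, ∀ᶠ B in W, z B = z₀ :=
    Ultrafilter.eventually_exists_iff.1 (all fun B => ⟨z B, rfl⟩)
  intro hSF
  refine (hSF L hLA z₀ ?_).not_ge ((hLA.1.le_opNorm_iff hd _ _).2
    ⟨v₀, by simpa using hv₀, ?_⟩)
  · obtain ⟨B, hB⟩ := hz₀.exists
    exact hB ▸ hz B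
  · refine le_of_tendsto_of_tendsto ((hρ.pow n).mul (hL _ _ hvv)) (hL _ _ (tendsto_mulVec
      (((continuous_wordProd z₀).tendsto A.1).comp hWA) hvv)) ?_
    filter_upwards [hz₀] with B hB
    exact hB ▸ hexp B

end JSR

theorem theorem1 {𝕜 : Type*} [RCLike 𝕜] (r d n : ℕ) (hr : 0 < r) (hd : 0 < d) (hn : 0 < n)
    (ω : JSR.Word r n) :
    IsOpen {A : JSR.IrrTuple 𝕜 r d | JSR.StrongFinitenessWith A ω} :=
  JSR.isOpen_strongFinitenessWith hd ω
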